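/- \textbf{Model.} Let $h_1,h_2,h_3\in\mathbb R$ and $P\ge 0$. In the (non-restricted, reciprocal) Gaussian Y-channel three users communicate through a relay. For every ordered pair $(j,k)$ of distinct users in $\{1,2,3\}$, user $j$ has a message $m_{jk}$ for user $k$. A code of block length $n$ for a rate tuple $\vec R=(R_{jk})_{j\ne k}\in\mathbb R_{\ge 0}^6$ has message sets $\mathcal M_{jk}=\{m\in\mathbb N: 1\le m\le 2^{nR_{jk}}\}$ and the following measurable maps, where $i=1,\dots,n$ and $\{j,k,l\}=\{1,2,3\}$: user encoders $x_{ji}=f_{ji}(m_{jk},m_{jl},y_j^{i-1})$, relay encoders $x_{ri}=f_{ri}(y_r^{i-1})$, and decoders $(\hat m_{kj},\hat m_{lj})=g_j(y_j^n,m_{jk},m_{jl})$. Here $y^{i-1}=(y_1,\dots,y_{i-1})$ denotes the symbols received at a node before time $i$. The channel is \[ y_{ri}=h_1x_{1i}+h_2x_{2i}+h_3x_{3i}+z_{ri},\qquad y_{ji}=h_jx_{ri}+z_{ji}\quad(j=1,2,3), \] where all the noise variables $z_{ri},z_{1i},z_{2i},z_{3i}$ are independent $\mathcal N(0,1)$ variables.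 The six messages are independent, uniformly distributed on their sets, and independent of the noise. The code must satisfy the power constraints $\frac1n\sum_{i=1}^n\mathbb E[X_{ji}^2]\le P$ for $j=1,2,3$ and $\frac1n\sum_{i=1}^n\mathbb E[X_{ri}^2]\le P$. Its error probability is the probability that $(\hat m_{kj},\hat m_{lj})\ne(m_{kj},m_{lj})$ for some user $j$. A tuple $\vec R\in\mathbb R_{\ge0}^6$ is achievable if there is a sequence of such codes, one for each block length $n$, whose error probability tends to $0$ as $n\to\infty$. \textbf{Lemma.} If $\vec R$ is achievable in the Y-channel, then for all distinct $j,k,l\in\{1,2,3\}$ \[ R_{kj}+R_{lj}+R_{kl}\le C\big((h_j^2+h_l^2)P\big),\qquad\text{where } C(x)=\tfrac12\log_2(1+x). \] -/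

import Mathlib

open MeasureTheory ProbabilityTheory Filter Topology

namespace YChannel

/-- Ordered pairs `(j, k)` of distinct users; such a pair stands for the message `m_jk`
which user `j` has for user `k`. -/
abbrev UserPair := {p : Fin 3 × Fin 3 // p.1 ≠ p.2}

/-- The number of elements of `{1, …, 2 ^ (n R_jk)}`, the set of positive integers up to
`2 ^ (n R_jk)`. -/
noncomputable abbrev numMessages (n : ℕ) (R : UserPair → ℝ) (p : UserPair) : ℕ :=
  ⌊(2 : ℝ) ^ ((n : ℝ) * R p)⌋₊

/-- The vector of all six messages. -/
abbrev Messages (n : ℕ) (R : UserPair → ℝ) := (p : UserPair) → Fin (numMessages n R p)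

/-- The two messages `(m_jk, m_jl)` that user `j` sends. -/
abbrev Outgoing (n : ℕ) (R : UserPair → ℝ) (j : Fin 3) :=
  (k : {k : Fin 3 // k ≠ j}) → Fin (numMessages n R ⟨(j, k.1), k.2.symm⟩)

/-- The two messages `(m_kj, m_lj)` that user `j` wants. -/
abbrev Incoming (n : ℕ) (R : UserPair → ℝ) (j : Fin 3) :=
  (k : {k : Fin 3 // k ≠ j}) → Fin (numMessages n R ⟨(k.1, j), k.2⟩)

/-- The messages of user `j` within the vector of all messages. -/
def outgoing {n : ℕ} {R : UserPair → ℝ} (m : Messages n R) (j : Fin 3) : Outgoing n R j :=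
  fun k => m ⟨(j, k.1), k.2.symm⟩

/-- The messages intended for user `j` within the vector of all messages. -/
def incoming {n : ℕ} {R : UserPair → ℝ} (m : Messages n R) (j : Fin 3) : Incoming n R j :=
  fun k => m ⟨(k.1, j), k.2⟩

/-- A code of block length `n` and rate tuple `R` with non-restricted encoding. Times are
numbered `0, …, n - 1`, so that a node has received the symbols with index in `Fin i` when it
chooses its symbol with index `i`. -/
structure Code (n : ℕ) (R : UserPair → ℝ) where
  /-- `x_ji = f_ji (m_jk, m_jl, y_j^(i-1))` -/
  userEnc : (j : Fin 3) → (i : Fin n) → Outgoing n R j → (Fin i → ℝ) → ℝ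
  measurable_userEnc : ∀ j i w, Measurable (userEnc j i w)
  /-- `x_ri = f_ri (y_r^(i-1))` -/
  relayEnc : (i : Fin n) → (Fin i → ℝ) → ℝ
  measurable_relayEnc : ∀ i, Measurable (relayEnc i)
  /-- `(m̂_kj, m̂_lj) = g_j (y_j^n, m_jk, m_jl)` -/
  dec : (j : Fin 3) → (Fin n → ℝ) → Outgoing n R j → Incoming n R j
  measurable_dec : ∀ j w, Measurable fun y => dec j y w

/-- Noise realisations: those of the users (user, then time) and that of the relay. -/
abbrev Noise (n : ℕ) := (Fin 3 → Fin n → ℝ) × (Fin n → ℝ)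

/-- All noise variables are independent and standard Gaussian. -/
noncomputable def noiseMeasure (n : ℕ) : Measure (Noise n) :=
  (Measure.pi fun _ : Fin 3 => Measure.pi fun _ : Fin n => gaussianReal 0 1).prod
    (Measure.pi fun _ : Fin n => gaussianReal 0 1)

/-- The joint law of the messages and the noise: the messages are independent and uniformly
distributed, and independent of the noise. -/
noncomputable def law (n : ℕ) (R : UserPair → ℝ) : Measure (Messages n R × Noise n) :=
  (uniformOn (Set.univ : Set (Messages n R))).prod (noiseMeasure n)

variable {n : ℕ} {R : UserPair → ℝ}

/-- The symbols `((y_1i, y_2i, y_3i), y_ri)` received at time `i` by the users and the relay, for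
given messages and noise, when the code is run over the channel with coefficients `h`. -/
noncomputable def received (c : Code n R) (h : Fin 3 → ℝ) (ω : Messages n R × Noise n)
    (i : Fin n) : (Fin 3 → ℝ) × ℝ :=
  (fun j => h j * c.relayEnc i (fun t => (received c h ω ⟨t, t.2.trans i.2⟩).2) + ω.2.1 j i,
    ∑ j, h j * c.userEnc j i (outgoing ω.1 j)
      (fun t => (received c h ω ⟨t, t.2.trans i.2⟩).1 j) + ω.2.2 i)
termination_by i.val
decreasing_by all_goals exact t.2

/-- `y_ji` -/
noncomputable def userOutput (c : Code n R) (h : Fin 3 → ℝ) (ω : Messages n R × Noise n)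
    (j : Fin 3) (i : Fin n) : ℝ := (received c h ω i).1 j

/-- `y_ri` -/
noncomputable def relayOutput (c : Code n R) (h : Fin 3 → ℝ) (ω : Messages n R × Noise n)
    (i : Fin n) : ℝ := (received c h ω i).2

/-- `x_ji` -/
noncomputable def userInput (c : Code n R) (h : Fin 3 → ℝ) (ω : Messages n R × Noise n)
    (j : Fin 3) (i : Fin n) : ℝ :=
  c.userEnc j i (outgoing ω.1 j) fun t => userOutput c h ω j ⟨t, t.2.trans i.2⟩

/-- `x_ri` -/
noncomputable def relayInput (c : Code n R) (h : Fin 3 → ℝ) (ω : Messages n R × Noise n)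
    (i : Fin n) : ℝ :=
  c.relayEnc i fun t => relayOutput c h ω ⟨t, t.2.trans i.2⟩

/-- The channel from the relay to the users: `y_ji = h_j x_ri + z_ji`. -/
theorem userOutput_eq (c : Code n R) (h : Fin 3 → ℝ) (ω : Messages n R × Noise n)
    (j : Fin 3) (i : Fin n) :
    userOutput c h ω j i = h j * relayInput c h ω i + ω.2.1 j i := by
  rw [userOutput, received]
  rfl

/-- The channel from the users to the relay: `y_ri = h_1 x_1i + h_2 x_2i + h_3 x_3i + z_ri`. -/
theorem relayOutput_eq (c : Code n R) (h : Fin 3 → ℝ) (ω : Messages n R × Noise n)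
    (i : Fin n) :
    relayOutput c h ω i = ∑ j, h j * userInput c h ω j i + ω.2.2 i := by
  rw [relayOutput, received]
  rfl

/-- A sequence of random variables has finite second moments, of average at most `P`. -/
def PowerConstraint (P : ℝ) (X : Messages n R × Noise n → Fin n → ℝ) : Prop :=
  (∀ i, Integrable (fun ω => X ω i ^ 2) (law n R)) ∧
    1 / (n : ℝ) * ∑ i, ∫ ω, X ω i ^ 2 ∂(law n R) ≤ P

/-- The code meets the power constraints of the three users and of the relay. -/
def Code.IsPowerLimited (c : Code n R) (h : Fin 3 → ℝ) (P : ℝ) : Prop :=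
  (∀ j, PowerConstraint P fun ω => userInput c h ω j) ∧ PowerConstraint P (relayInput c h)

/-- The average error probability: the probability that some user does not decode both of
its messages correctly. -/
noncomputable def Code.errorProb (c : Code n R) (h : Fin 3 → ℝ) : ℝ :=
  (law n R).real
    {ω | ∃ j, c.dec j (userOutput c h ω j) (outgoing ω.1 j) ≠ incoming ω.1 j}

/-- Achievability of a rate tuple (in bits per channel use) in the non-restricted Y-channel with
coefficients `h` and power `P`. -/
def Achievable (h : Fin 3 → ℝ) (P : ℝ) (R : UserPair → ℝ) : Prop :=
  (∀ p, 0 ≤ R p) ∧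
    ∃ c : (n : ℕ) → Code n R, (∀ n, (c n).IsPowerLimited h P) ∧
      Tendsto (fun n => (c n).errorProb h) atTop (𝓝 0)

/-- `C(x) = (1/2) log (1 + x)`, in bits. -/
noncomputable def C (x : ℝ) : ℝ := 1 / 2 * Real.logb 2 (1 + x)

end YChannel

namespace YChannel

/-! ### Gaussian densities and measure-preserving triangular maps -/

section General

/-! This is a genie-aided converse for users `j` and `l`, carried out by a change of measure instead
of entropies. Fix the messages and the relay noise. By causality the relay input at time `i` depends
only on user noise before time `i`, so replacing the noises of users `j` and `l` by their outputs is
a triangular map and preserves Lebesgue measure (`lintegral_triangular`). Weighting by `exp (-L)`,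
with `L` the sum of the information densities, therefore turns the output law into a fixed Gaussian
law that depends neither on the messages nor on the relay noise
(`lintegral_userOutput_mul_exp_neg_infoDensity`).

Under that law correct decoding is a guess. Given both outputs and `m_jk`, `m_jl`, `m_lk`, decoder
`j` yields `m_kj` and `m_lj`; then all messages sent by `l` are known, and decoder `l` yields `m_kl`
(`card_decodesAt_le`). The success probability is thus at most `1 / N`, where `N` counts the triples
`(m_kj, m_lj, m_kl)`.

A Fano-type inequality (`measureReal_mul_log_le`) gives `(1 - error) * log N ≤ E L + log 2`, and the
power constraint gives `E L ≤ n * log (1 + (h_j² + h_l²) P) / 2` (`integral_sum_infoDensity_le`).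
Dividing by `n` and letting `n → ∞` finishes the proof. -/

theorem lintegral_fin_prod_eq_prod {α : Type*} [MeasurableSpace α] (μ : Measure α) [SigmaFinite μ]
    {n : ℕ} (f : Fin n → α → ENNReal) (hf : ∀ i, Measurable (f i)) :
    ∫⁻ x, ∏ i, f i (x i) ∂(Measure.pi fun _ : Fin n => μ) = ∏ i, ∫⁻ x, f i x ∂μ := by
  induction n with
  | zero => simp
  | succ n ih =>
    have hm := (measurePreserving_piFinSuccAbove (fun _ : Fin (n + 1) => μ) 0)
    have hg : Measurable fun y : Fin n → α => ∏ i, f i.succ (y i) :=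
      Finset.measurable_prod _ fun i _ => (hf i.succ).comp (measurable_pi_apply i)
    calc ∫⁻ x, ∏ i, f i (x i) ∂(Measure.pi fun _ : Fin (n + 1) => μ)
        = ∫⁻ x, (fun p : α × (Fin n → α) => f 0 p.1 * ∏ i, f i.succ (p.2 i))
            (MeasurableEquiv.piFinSuccAbove (fun _ => α) 0 x)
            ∂(Measure.pi fun _ : Fin (n + 1) => μ) := by
          refine lintegral_congr fun x => ?_
          rw [Fin.prod_univ_succ]
          rfl
      _ = ∫⁻ p, f 0 p.1 * ∏ i, f i.succ (p.2 i) ∂(μ.prod (Measure.pi fun _ : Fin n => μ)) := by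
          refine hm.lintegral_comp
            (f := fun p : α × (Fin n → α) => f 0 p.1 * ∏ i, f i.succ (p.2 i)) ?_
          exact ((hf 0).comp measurable_fst).mul (hg.comp measurable_snd)
      _ = _ := by
          rw [lintegral_prod_mul (hf 0).aemeasurable hg.aemeasurable,
            ih (fun i => f i.succ) fun i => hf i.succ, Fin.prod_univ_succ]

theorem pi_fin_withDensity {α : Type*} [MeasurableSpace α] (μ : Measure α) [SigmaFinite μ]
    {n : ℕ} (f : Fin n → α → ENNReal) (hf : ∀ i, Measurable (f i))
    [∀ i, SigmaFinite (μ.withDensity (f i))] :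
    (Measure.pi fun i => μ.withDensity (f i)) =
      (Measure.pi fun _ : Fin n => μ).withDensity fun x => ∏ i, f i (x i) := by
  refine Measure.pi_eq fun s hs => ?_
  rw [withDensity_apply _ (MeasurableSet.univ_pi hs),
    ← lintegral_indicator (MeasurableSet.univ_pi hs)]
  have : ∀ x : Fin n → α, (Set.univ.pi s).indicator (fun x => ∏ i, f i (x i)) x
      = ∏ i, (s i).indicator (f i) (x i) := by
    intro x
    by_cases hx : x ∈ Set.univ.pi s
    · rw [Set.indicator_of_mem hx]
      exact Finset.prod_congr rfl fun i _ => (Set.indicator_of_mem (hx i trivial) _).symm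
    · rw [Set.indicator_of_notMem hx]
      simp only [Set.mem_pi, Set.mem_univ, forall_const, not_forall] at hx
      obtain ⟨i, hi⟩ := hx
      exact (Finset.prod_eq_zero (Finset.mem_univ i) (Set.indicator_of_notMem hi _)).symm
  simp_rw [this]
  rw [lintegral_fin_prod_eq_prod μ _ fun i => (hf i).indicator (hs i)]
  refine Finset.prod_congr rfl fun i _ => ?_
  rw [lintegral_indicator (hs i), withDensity_apply _ (hs i)]

/-- Makes Lebesgue measure the reference measure, so that shears can act on the noise. Unequal
variances serve to normalise `outputDensity`. -/
theorem pi_pi_gaussianReal (m n : ℕ) (v : Fin m → NNReal) (hv : ∀ a, v a ≠ 0) :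
    (Measure.pi fun a : Fin m => Measure.pi fun _ : Fin n => gaussianReal 0 (v a)) =
      (volume : Measure (Fin m → Fin n → ℝ)).withDensity fun z =>
        ∏ a, ∏ i, gaussianPDF 0 (v a) (z a i) := by
  have h1 : ∀ a, (Measure.pi fun _ : Fin n => gaussianReal 0 (v a)) =
      (volume : Measure (Fin n → ℝ)).withDensity fun x => ∏ i, gaussianPDF 0 (v a) (x i) := by
    intro a
    have : IsProbabilityMeasure ((volume : Measure ℝ).withDensity (gaussianPDF 0 (v a))) := by
      rw [← gaussianReal_of_var_ne_zero 0 (hv a)]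
      infer_instance
    rw [gaussianReal_of_var_ne_zero 0 (hv a), pi_fin_withDensity (volume : Measure ℝ)
      (fun _ : Fin n => gaussianPDF 0 (v a)) fun _ => measurable_gaussianPDF _ _]
    rfl
  have h2 : ∀ a, IsProbabilityMeasure ((volume : Measure (Fin n → ℝ)).withDensity
      fun x => ∏ i, gaussianPDF 0 (v a) (x i)) := by
    intro a
    rw [← h1]
    infer_instance
  simp_rw [h1]
  rw [pi_fin_withDensity (volume : Measure (Fin n → ℝ))
    (fun a x => ∏ i, gaussianPDF 0 (v a) (x i))]
  · rfl
  · intro a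
    exact Finset.measurable_prod _ fun i _ =>
      (measurable_gaussianPDF _ _).comp (measurable_pi_apply i)

variable {E : Type*} [AddCommGroup E] [Module ℝ E] [MeasurableSpace E] [MeasurableAdd₂ E]
  [MeasurableSMul₂ ℝ E] (μ : Measure E) [SFinite μ] [μ.IsAddRightInvariant]

/-- A shear `z ↦ z + x z • e`, where `x` is constant along `e`, preserves every translation
invariant measure. -/
theorem lintegral_shear (e : E) (x : E → ℝ) (hx : Measurable x)
    (hxe : ∀ z (t : ℝ), x (z + t • e) = x z) (f : E → ENNReal) (hf : Measurable f) :
    ∫⁻ z, f (z + x z • e) ∂μ = ∫⁻ z, f z ∂μ := by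
  -- An auxiliary probability density on the line: averaging over translations along `e` lets
  -- Tonelli and one-dimensional translation invariance absorb the shift `x z`, with no Jacobian.
  set ρ : ℝ → ENNReal := gaussianPDF 0 1
  have hρ : Measurable ρ := measurable_gaussianPDF 0 1
  have h1 : ∫⁻ s, ρ s = 1 := lintegral_gaussianPDF_eq_one 0 one_ne_zero
  have hm : Measurable fun p : E × ℝ => f (p.1 + p.2 • e) := by fun_prop
  calc ∫⁻ z, f (z + x z • e) ∂μ
      = ∫⁻ s, ρ s * ∫⁻ z, f (z + x z • e) ∂μ := by
        rw [lintegral_mul_const _ hρ, h1, one_mul]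
    _ = ∫⁻ s, ∫⁻ z, ρ s * f (z + (x z + -s) • e) ∂μ := by
        refine lintegral_congr fun s => ?_
        rw [lintegral_const_mul _ (by fun_prop),
          ← lintegral_add_right_eq_self (fun z => f (z + x z • e)) (-s • e)]
        congr 1
        refine lintegral_congr fun z => ?_
        simp only [hxe]
        congr 1
        module
    _ = ∫⁻ z, ∫⁻ s, ρ s * f (z + (x z + -s) • e) ∂volume ∂μ := by
        refine lintegral_lintegral_swap (Measurable.aemeasurable ?_)
        unfold Function.uncurry
        fun_prop
    _ = ∫⁻ z, ∫⁻ s, ρ (s + x z) * f (z + (-s) • e) ∂volume ∂μ := by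
        refine lintegral_congr fun z => ?_
        rw [← lintegral_add_right_eq_self _ (x z)]
        refine lintegral_congr fun s => ?_
        congr 3
        module
    _ = ∫⁻ s, ∫⁻ z, ρ (s + x z) * f (z + (-s) • e) ∂μ := by
        refine lintegral_lintegral_swap (Measurable.aemeasurable ?_)
        unfold Function.uncurry
        fun_prop
    _ = ∫⁻ s, ∫⁻ z, ρ (s + x z) * f z ∂μ := by
        refine lintegral_congr fun s => ?_
        rw [← lintegral_add_right_eq_self (fun z => ρ (s + x z) * f z) ((-s) • e)]
        simp only [hxe]
    _ = ∫⁻ z, ∫⁻ s, ρ (s + x z) * f z ∂volume ∂μ := by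
        refine lintegral_lintegral_swap (Measurable.aemeasurable ?_)
        unfold Function.uncurry
        fun_prop
    _ = ∫⁻ z, f z ∂μ := by
        refine lintegral_congr fun z => ?_
        rw [lintegral_mul_const _ (by fun_prop), lintegral_add_right_eq_self ρ (x z), h1, one_mul]

/-- A map `z ↦ z + ∑ i, x i z • e i`, where `x i` is constant along `e j` for `j ≥ i`, preserves
every translation invariant measure. -/
theorem lintegral_triangular {ι : Type*} [LinearOrder ι] (e : ι → E) (x : ι → E → ℝ)
    (hx : ∀ i, Measurable (x i))
    (hxe : ∀ i j, i ≤ j → ∀ z (t : ℝ), x i (z + t • e j) = x i z) (s : Finset ι)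
    (f : E → ENNReal) (hf : Measurable f) :
    ∫⁻ z, f (z + ∑ i ∈ s, x i z • e i) ∂μ = ∫⁻ z, f z ∂μ := by
  induction s using Finset.induction_on_min generalizing f with
  | empty => simp
  | insert a s has ih =>
    have key : ∀ (u : Finset ι) (t : ι → ℝ) (z : E), (∀ i ∈ u, a ≤ i) →
        x a (z + ∑ i ∈ u, t i • e i) = x a z := by
      intro u t z hu
      induction u using Finset.induction_on with
      | empty => simp
      | insert b u hb ihu =>
        rw [Finset.sum_insert hb, add_comm (t b • e b), ← add_assoc, hxe a b (hu b (by simp))]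
        exact ihu fun i hi => hu i (by simp [hi])
    -- The map for `insert a s` is the map for `s` followed by the shear along `e a`; by `key`, `x
    -- a` does not notice the displacement along the later directions.
    rw [← lintegral_shear μ (e a) (x a) (hx a) (hxe a a le_rfl) f hf,
      ← ih (fun z => f (z + x a z • e a)) (by have := hx a; fun_prop)]
    refine lintegral_congr fun z => ?_
    have h1 : a ∉ s := fun h => (has a h).false
    rw [key s (fun i => x i z) z fun i hi => (has i hi).le, Finset.sum_insert h1]
    congr 1
    abel

end General

variable {n : ℕ} {R : UserPair → ℝ}

/-! ### Causality and measurability of the channel recursion -/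

section Causality

theorem received_congr (c : Code n R) (h : Fin 3 → ℝ) (m : Messages n R) (w : Fin n → ℝ)
    {z z' : Fin 3 → Fin n → ℝ} (i : Fin n) (hz : ∀ a, ∀ t ≤ i, z a t = z' a t) :
    received c h (m, z, w) i = received c h (m, z', w) i := by
  induction i using WellFoundedLT.induction with
  | ind i ih =>
    have hr : ∀ t : Fin i, received c h (m, z, w) ⟨t, t.2.trans i.2⟩ =
        received c h (m, z', w) ⟨t, t.2.trans i.2⟩ := fun t =>
      ih _ t.2 fun a s hs => hz a s (hs.trans (le_of_lt t.2))
    rw [received, received]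
    simp only [hr, hz _ i le_rfl]

/-- The inequality `t < i` is strict because the relay has only seen outputs from before time `i`.
This is what makes the map from noise to outputs triangular, and `x_ri` uncorrelated with the user
noise at time `i`. -/
theorem relayInput_congr (c : Code n R) (h : Fin 3 → ℝ) (m : Messages n R) (w : Fin n → ℝ)
    {z z' : Fin 3 → Fin n → ℝ} (i : Fin n) (hz : ∀ a, ∀ t < i, z a t = z' a t) :
    relayInput c h (m, z, w) i = relayInput c h (m, z', w) i := by
  unfold relayInput relayOutput
  congr 1
  funext t
  rw [received_congr c h m w _ fun a s hs => hz a s (lt_of_le_of_lt hs t.2)]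

theorem measurable_received (c : Code n R) (h : Fin 3 → ℝ) (i : Fin n) :
    Measurable fun ω => received c h ω i := by
  refine measurable_from_prod_countable_right fun m => ?_
  induction i using WellFoundedLT.induction with
  | ind i ih =>
    have hr : ∀ t : Fin i, Measurable fun ν : Noise n =>
      received c h (m, ν) ⟨t, t.2.trans i.2⟩ := fun t => ih _ t.2
    conv => arg 1; ext ν; rw [received]
    refine Measurable.prodMk (measurable_pi_lambda _ fun a => ?_) ?_
    · refine Measurable.add (Measurable.const_mul ?_ _) (by fun_prop)
      exact (c.measurable_relayEnc i).comp (measurable_pi_lambda _ fun t => (hr t).snd)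
    · refine Measurable.add (Finset.measurable_sum _ fun a _ => Measurable.const_mul ?_ _)
        (by fun_prop)
      exact (c.measurable_userEnc a i (outgoing m a)).comp
        (measurable_pi_lambda _ fun t => (measurable_pi_iff.1 (hr t).fst a))

theorem measurable_userOutput (c : Code n R) (h : Fin 3 → ℝ) (a : Fin 3) :
    Measurable fun ω => userOutput c h ω a :=
  measurable_pi_lambda _ fun i => (measurable_pi_apply a).comp (measurable_received c h i).fst

theorem measurable_relayInput (c : Code n R) (h : Fin 3 → ℝ) (i : Fin n) :
    Measurable fun ω => relayInput c h ω i :=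
  (c.measurable_relayEnc i).comp
    (measurable_pi_lambda _ fun _ => (measurable_received c h _).snd)

end Causality

/-! ### The single-letter likelihood ratio -/

section InfoDensity

/-- The logarithm of the likelihood ratio between the channel law `N((a x, b x), I)` at the output
`(z + a x, w + b x)` and the centred Gaussian output law which belongs to an input of
variance `P`. -/
noncomputable def infoDensity (P a b x z w : ℝ) : ℝ :=
  Real.log (1 + (a ^ 2 + b ^ 2) * P) / 2 + x * (a * z + b * w) + (a ^ 2 + b ^ 2) * x ^ 2 / 2 -
    P / (1 + (a ^ 2 + b ^ 2) * P) / 2 * (a * z + b * w + (a ^ 2 + b ^ 2) * x) ^ 2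

/-- The right side is the density of `N(0, I + P (a, b) (a, b)ᵀ)`, factored as the marginal of the
first output times the conditional density of the second given the first. The determinant `1 + (a² +
b²) P` is the product of the two variances. -/
theorem gaussianPDFReal_mul_exp_neg_infoDensity {P : ℝ} (hP : 0 ≤ P) (a b x z w : ℝ) :
    gaussianPDFReal 0 1 z * gaussianPDFReal 0 1 w * Real.exp (-infoDensity P a b x z w) =
      gaussianPDFReal 0 (Real.toNNReal (1 + a ^ 2 * P)) (z + a * x) *
      gaussianPDFReal 0 (Real.toNNReal ((1 + (a ^ 2 + b ^ 2) * P) / (1 + a ^ 2 * P)))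
        (w + b * x - a * b * P / (1 + a ^ 2 * P) * (z + a * x)) := by
  have h1 : 0 < 1 + a ^ 2 * P := by positivity
  have h2 : 0 < 1 + (a ^ 2 + b ^ 2) * P := by positivity
  simp only [gaussianPDFReal_def, Real.coe_toNNReal _ h1.le, Real.coe_toNNReal _ (div_pos h2 h1).le,
    NNReal.coe_one]
  have hlog : Real.exp (-(Real.log (1 + (a ^ 2 + b ^ 2) * P) / 2)) =
      (√(1 + (a ^ 2 + b ^ 2) * P))⁻¹ := by
    rw [Real.exp_neg, ← Real.log_sqrt h2.le, Real.exp_log (Real.sqrt_pos.2 h2)]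
  have hc : (√(2 * Real.pi * 1))⁻¹ * (√(2 * Real.pi * 1))⁻¹ * (√(1 + (a ^ 2 + b ^ 2) * P))⁻¹ =
      (√(2 * Real.pi * (1 + a ^ 2 * P)))⁻¹ *
      (√(2 * Real.pi * ((1 + (a ^ 2 + b ^ 2) * P) / (1 + a ^ 2 * P))))⁻¹ := by
    rw [← mul_inv, ← mul_inv, ← mul_inv, ← Real.sqrt_mul (by positivity),
      ← Real.sqrt_mul (by positivity), ← Real.sqrt_mul (by positivity)]
    congr 2
    field_simp
  set E := -(z + a * x - 0) ^ 2 / (2 * (1 + a ^ 2 * P)) with hE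
  set F := -(w + b * x - a * b * P / (1 + a ^ 2 * P) * (z + a * x) - 0) ^ 2 /
    (2 * ((1 + (a ^ 2 + b ^ 2) * P) / (1 + a ^ 2 * P))) with hF
  have hexp : -(z - 0) ^ 2 / (2 * 1) + -(w - 0) ^ 2 / (2 * 1) + -infoDensity P a b x z w =
      -(Real.log (1 + (a ^ 2 + b ^ 2) * P) / 2) + (E + F) := by
    rw [hE, hF]
    unfold infoDensity
    field_simp
    ring
  calc _ = (√(2 * Real.pi * 1))⁻¹ * (√(2 * Real.pi * 1))⁻¹ *
        Real.exp (-(z - 0) ^ 2 / (2 * 1) + -(w - 0) ^ 2 / (2 * 1) + -infoDensity P a b x z w) := by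
        rw [Real.exp_add, Real.exp_add]; ring
    _ = ((√(2 * Real.pi * 1))⁻¹ * (√(2 * Real.pi * 1))⁻¹ * (√(1 + (a ^ 2 + b ^ 2) * P))⁻¹) *
        (Real.exp E * Real.exp F) := by
        rw [hexp, Real.exp_add, Real.exp_add, hlog]; ring
    _ = _ := by rw [hc]; ring

end InfoDensity

/-! ### Change of measure for the whole block -/

section ChangeOfMeasure

theorem prod_user {M : Type*} [CommMonoid M] (f : Fin 3 → M) {j k l : Fin 3} (hjk : j ≠ k)
    (hjl : j ≠ l) (hkl : k ≠ l) : ∏ a, f a = f j * f l * f k := by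
  have : (Finset.univ : Finset (Fin 3)) = {j, l, k} := by decide +revert
  rw [this, Finset.prod_insert (by simp [hjk, hjl]), Finset.prod_insert (by simp [hkl.symm]),
    Finset.prod_singleton, mul_assoc]

/-- Density of the law of the user outputs when those of users `j` and `l` at each time are jointly
Gaussian with covariance matrix `I + P (h_j, h_l) (h_j, h_l)ᵀ`, that of user `k` is standard
Gaussian, and the outputs are independent otherwise. -/
noncomputable def outputDensity (h : Fin 3 → ℝ) (P : ℝ) (j k l : Fin 3)
    (y : Fin 3 → Fin n → ℝ) : ENNReal :=
  ∏ i, (gaussianPDF 0 (Real.toNNReal (1 + h j ^ 2 * P)) (y j i) *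
    gaussianPDF 0 (Real.toNNReal ((1 + (h j ^ 2 + h l ^ 2) * P) / (1 + h j ^ 2 * P)))
      (y l i - h j * h l * P / (1 + h j ^ 2 * P) * y j i) *
    gaussianPDF 0 1 (y k i))

theorem measurable_outputDensity (h : Fin 3 → ℝ) (P : ℝ) (j k l : Fin 3) :
    Measurable (outputDensity (n := n) h P j k l) := by
  unfold outputDensity
  have := measurable_gaussianPDF
  fun_prop

theorem lintegral_outputDensity (h : Fin 3 → ℝ) {P : ℝ} (hP : 0 ≤ P) {j k l : Fin 3} (hjk : j ≠ k)
    (hjl : j ≠ l) (hkl : k ≠ l) :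
    ∫⁻ y, outputDensity (n := n) h P j k l y = 1 := by
  have h1 : 0 < 1 + h j ^ 2 * P := by positivity
  have h2 : 0 < (1 + (h j ^ 2 + h l ^ 2) * P) / (1 + h j ^ 2 * P) := by positivity
  set β := h j * h l * P / (1 + h j ^ 2 * P) with hβ
  set V : Fin 3 → NNReal := fun a => if a = j then Real.toNNReal (1 + h j ^ 2 * P) else
    if a = l then Real.toNNReal ((1 + (h j ^ 2 + h l ^ 2) * P) / (1 + h j ^ 2 * P)) else 1 with hV
  have hV0 : ∀ a, V a ≠ 0 := by
    intro a
    simp only [hV]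
    split_ifs <;> simp [h1, h2]
  let G : (Fin 3 → Fin n → ℝ) → ENNReal := fun z => ∏ a, ∏ i, gaussianPDF 0 (V a) (z a i)
  have hGm : Measurable G := by
    have := measurable_gaussianPDF
    fun_prop
  have hG : ∫⁻ z, G z = 1 := by
    have := congrArg (fun μ => μ Set.univ) (pi_pi_gaussianReal 3 n V hV0)
    simp only [measure_univ, withDensity_apply _ MeasurableSet.univ, Measure.restrict_univ] at this
    exact this.symm
  -- Subtracting the regression `β * y_j` from `y_l` decorrelates the outputs. It is a shear, since
  -- the shift does not involve `y_l`.
  rw [← hG, ← lintegral_triangular volume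
    (fun i : Fin n => (Pi.single l (Pi.single i 1) : Fin 3 → Fin n → ℝ))
    (fun i z => -(β * z j i)) (fun i => by fun_prop) (fun i i' _ z t => by simp [hjl]) Finset.univ
    G hGm]
  refine lintegral_congr fun y => ?_
  have hy : ∀ a i, (y + ∑ t, -(β * y j t) • (Pi.single l (Pi.single t 1) : Fin 3 → Fin n → ℝ)) a i
      = y a i - if a = l then β * y j i else 0 := by
    intro a i
    by_cases ha : a = l
    · subst ha
      simp [Finset.sum_apply, Pi.single_apply, sub_eq_add_neg]
    · simp [Finset.sum_apply, ha]
  simp only [G, hy]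
  rw [prod_user _ hjk hjl hkl, ← Finset.prod_mul_distrib, ← Finset.prod_mul_distrib]
  simp [outputDensity, hV, hjl, hjl.symm, hjk.symm, hkl, ← hβ]

/-- Change of measure to the Gaussian output law, for fixed messages and relay noise. -/
theorem lintegral_userOutput_mul_exp_neg_infoDensity (c : Code n R) (h : Fin 3 → ℝ) {P : ℝ}
    (hP : 0 ≤ P) {j k l : Fin 3} (hjk : j ≠ k) (hjl : j ≠ l) (hkl : k ≠ l) (m : Messages n R)
    (w : Fin n → ℝ) (f : (Fin n → ℝ) × (Fin n → ℝ) → ENNReal) (hf : Measurable f) :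
    ∫⁻ z, f (userOutput c h (m, z, w) j, userOutput c h (m, z, w) l) *
        ENNReal.ofReal (Real.exp (-∑ i, infoDensity P (h j) (h l) (relayInput c h (m, z, w) i)
          (z j i) (z l i)))
        ∂(Measure.pi fun _ : Fin 3 => Measure.pi fun _ : Fin n => gaussianReal 0 1) =
      ∫⁻ y, f (y j, y l) * outputDensity h P j k l y := by
  -- Coordinate `k` is not shifted: it keeps the noise of user `k`, whose output plays no role here.
  set v : Fin 3 → ℝ := fun a => if a = k then 0 else h a with hv
  let x : Fin n → (Fin 3 → Fin n → ℝ) → ℝ := fun i z => relayInput c h (m, z, w) i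
  have hx : ∀ i, Measurable (x i) := fun i =>
    (measurable_relayInput c h i).comp (by fun_prop)
  have hxm : Measurable fun z => -∑ i, infoDensity P (h j) (h l) (x i z) (z j i) (z l i) := by
    unfold infoDensity
    fun_prop
  have hFm : Measurable fun y : Fin 3 → Fin n → ℝ =>
      f (y j, y l) * outputDensity h P j k l y :=
    Measurable.mul (by fun_prop) (measurable_outputDensity ..)
  have ho : Measurable fun z => f (userOutput c h (m, z, w) j, userOutput c h (m, z, w) l) :=
    hf.comp (Measurable.prodMk ((measurable_userOutput c h j).comp (by fun_prop))
      ((measurable_userOutput c h l).comp (by fun_prop)))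
  have hgm : Measurable fun z => f (userOutput c h (m, z, w) j, userOutput c h (m, z, w) l) *
      ENNReal.ofReal (Real.exp (-∑ i, infoDensity P (h j) (h l) (relayInput c h (m, z, w) i)
        (z j i) (z l i))) := ho.mul (Real.measurable_exp.comp hxm).ennreal_ofReal
  rw [pi_pi_gaussianReal 3 n (fun _ => 1) fun _ => one_ne_zero,
    lintegral_withDensity_eq_lintegral_mul _
      (by have := measurable_gaussianPDF; fun_prop)
      hgm,
    ← lintegral_triangular volume (fun i : Fin n => (fun a => Pi.single i (v a))) x hx
      (fun i i' hi z t => relayInput_congr c h m w i fun a s hs => ?_) Finset.univ _ hFm]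
  · refine lintegral_congr fun z => ?_
    have hy : ∀ a i, (z + ∑ t, x t z • (fun a => Pi.single t (v a) : Fin 3 → Fin n → ℝ)) a i
        = z a i + v a * x i z := by
      intro a i
      simp [Finset.sum_apply, Pi.single_apply, mul_comm]
    have hyo : ∀ a, a ≠ k →
        (z + ∑ t, x t z • (fun a => Pi.single t (v a) : Fin 3 → Fin n → ℝ)) a =
        userOutput c h (m, z, w) a := by
      intro a ha
      funext i
      rw [hy, userOutput_eq, hv, add_comm]
      simp [ha, x]
    rw [hyo j hjk, hyo l hkl.symm, Pi.mul_apply, mul_left_comm]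
    congr 1
    rw [prod_user _ hjk hjl hkl, ← Finset.prod_mul_distrib, ← Finset.prod_mul_distrib,
      ← Finset.sum_neg_distrib, Real.exp_sum,
      ENNReal.ofReal_prod_of_nonneg fun i _ => (Real.exp_pos _).le, ← Finset.prod_mul_distrib]
    unfold outputDensity
    refine Finset.prod_congr rfl fun i _ => ?_
    have hid := congrArg ENNReal.ofReal
      (gaussianPDFReal_mul_exp_neg_infoDensity hP (h j) (h l) (x i z) (z j i) (z l i))
    rw [ENNReal.ofReal_mul
        (mul_nonneg (gaussianPDFReal_nonneg _ _ _) (gaussianPDFReal_nonneg _ _ _)),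
      ENNReal.ofReal_mul (gaussianPDFReal_nonneg _ _ _),
      ENNReal.ofReal_mul (gaussianPDFReal_nonneg _ _ _)] at hid
    simp only [hy]
    rw [show v j = h j by simp [hv, hjk], show v l = h l by simp [hv, hkl.symm],
      show v k = 0 by simp [hv], zero_mul, add_zero]
    simp only [gaussianPDF, x] at hid ⊢
    rw [← hid]
    ring
  -- A shift of the noise at time `i' ≥ i` is invisible to the relay input at time `i`.
  · have hne : s ≠ i' := (lt_of_lt_of_le hs hi).ne
    simp [hne]

end ChangeOfMeasure

/-! ### Expectation of the information density -/

section Expectation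

theorem nonempty_messages (n : ℕ) (hR : ∀ p, 0 ≤ R p) : Nonempty (Messages n R) := by
  refine ⟨fun p => ⟨0, Nat.floor_pos.2 (Real.one_le_rpow one_le_two ?_)⟩⟩
  have := hR p
  positivity

theorem isProbabilityMeasure_noiseMeasure (n : ℕ) : IsProbabilityMeasure (noiseMeasure n) := by
  unfold noiseMeasure
  infer_instance

theorem isProbabilityMeasure_messages [Nonempty (Messages n R)] :
    IsProbabilityMeasure (uniformOn (Set.univ : Set (Messages n R))) :=
  isProbabilityMeasure_uniformOn Set.finite_univ Set.univ_nonempty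

theorem isProbabilityMeasure_law [Nonempty (Messages n R)] :
    IsProbabilityMeasure (law n R) := by
  have := isProbabilityMeasure_messages (n := n) (R := R)
  have := isProbabilityMeasure_noiseMeasure n
  unfold law
  infer_instance

theorem measurePreserving_userNoise [Nonempty (Messages n R)] (a : Fin 3) (i : Fin n) :
    MeasurePreserving (fun ω : Messages n R × Noise n => ω.2.1 a i) (law n R)
      (gaussianReal 0 1) := by
  have := isProbabilityMeasure_messages (n := n) (R := R)
  have := isProbabilityMeasure_noiseMeasure n
  exact (((measurePreserving_eval (fun _ : Fin n => gaussianReal 0 1) i).comp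
    (measurePreserving_eval
      (fun _ : Fin 3 => Measure.pi fun _ : Fin n => gaussianReal 0 1) a)).comp
    measurePreserving_fst).comp measurePreserving_snd

theorem memLp_userNoise [Nonempty (Messages n R)] (a : Fin 3) (i : Fin n) :
    MemLp (fun ω : Messages n R × Noise n => ω.2.1 a i) 2 (law n R) :=
  (memLp_id_gaussianReal 2).comp_measurePreserving (measurePreserving_userNoise a i)

theorem integral_userNoise_sq [Nonempty (Messages n R)] (a : Fin 3) (i : Fin n) :
    ∫ ω, ω.2.1 a i ^ 2 ∂(law n R) = 1 := by
  have hm := measurePreserving_userNoise (n := n) (R := R) a i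
  have h1 : ∫ x, x ^ 2 ∂(gaussianReal 0 1) = 1 := by
    have h2 := variance_of_integral_eq_zero (μ := gaussianReal 0 1) (X := fun x => x)
      aemeasurable_id' (by simp)
    rw [variance_fun_id_gaussianReal] at h2
    simpa using h2.symm
  rw [← h1, ← hm.map_eq, integral_map hm.aemeasurable (by fun_prop)]

/-- A function which changes its sign when some of the user noise variables do has integral
zero. -/
theorem integral_eq_zero_of_reflect (s : Fin 3 → Fin n → Prop) [∀ a i, Decidable (s a i)]
    (f : Messages n R × Noise n → ℝ) (hf : Measurable f)
    (hs : ∀ m z w, f (m, (fun a i => if s a i then -z a i else z a i), w) = -f (m, z, w)) :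
    ∫ ω, f ω ∂(law n R) = 0 := by
  have h1 : ∀ a i, MeasurePreserving (fun x : ℝ => if s a i then -x else x) (gaussianReal 0 1)
      (gaussianReal 0 1) := by
    intro a i
    split_ifs
    · exact ⟨measurable_neg, by simpa using gaussianReal_map_neg (μ := 0) (v := 1)⟩
    · exact MeasurePreserving.id _
  have h2 : MeasurePreserving
      (fun ω : Messages n R × Noise n =>
        (ω.1, (fun a i => if s a i then -ω.2.1 a i else ω.2.1 a i), ω.2.2)) (law n R) (law n R) :=
    (MeasurePreserving.id _).prod
      ((measurePreserving_pi _ _ fun a => measurePreserving_pi _ _ fun i => h1 a i).prod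
        (MeasurePreserving.id _))
  -- Integrability is not needed: a non-integrable `f` has integral `0` by default, and
  -- `integral_neg` holds regardless.
  have h3 : ∫ ω, f ω ∂(law n R) = -∫ ω, f ω ∂(law n R) := by
    conv_lhs => rw [← h2.map_eq, integral_map h2.aemeasurable hf.aestronglyMeasurable]
    rw [← integral_neg]
    exact integral_congr_ae (Eventually.of_forall fun ω => hs ω.1 ω.2.1 ω.2.2)
  linarith

theorem integral_relayInput_mul_userNoise (c : Code n R) (h : Fin 3 → ℝ) (a : Fin 3)
    (i : Fin n) : ∫ ω, relayInput c h ω i * ω.2.1 a i ∂(law n R) = 0 := by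
  refine integral_eq_zero_of_reflect (fun b t => t = i) _
    ((measurable_relayInput c h i).mul (by fun_prop)) fun m z w => ?_
  rw [relayInput_congr c h m w (z' := z) i fun b t ht => by simp [ht.ne]]
  simp

theorem integral_userNoise_mul_userNoise {a b : Fin 3} (hab : a ≠ b) (i : Fin n) :
    ∫ ω, ω.2.1 a i * ω.2.1 b i ∂(law n R) = 0 := by
  refine integral_eq_zero_of_reflect (fun b t => b = a) _ (by fun_prop) fun m z w => ?_
  simp [hab.symm]

/-- All cross terms are odd under a reflection of noise and vanish, leaving an affine function of
the second moment of the relay input. No concavity argument is then needed to pass to average power.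
-/
theorem integral_infoDensity [Nonempty (Messages n R)] (c : Code n R) (h : Fin 3 → ℝ) {P : ℝ}
    (hP : 0 ≤ P) {j l : Fin 3} (hjl : j ≠ l) (i : Fin n)
    (hx : Integrable (fun ω => relayInput c h ω i ^ 2) (law n R)) :
    Integrable (fun ω => infoDensity P (h j) (h l) (relayInput c h ω i) (ω.2.1 j i) (ω.2.1 l i))
      (law n R) ∧
    ∫ ω, infoDensity P (h j) (h l) (relayInput c h ω i) (ω.2.1 j i) (ω.2.1 l i) ∂(law n R) =
      Real.log (1 + (h j ^ 2 + h l ^ 2) * P) / 2 +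
      (h j ^ 2 + h l ^ 2) / (2 * (1 + (h j ^ 2 + h l ^ 2) * P)) *
        (∫ ω, relayInput c h ω i ^ 2 ∂(law n R) - P) := by
  have := isProbabilityMeasure_law (n := n) (R := R)
  have h0 : 1 + (h j ^ 2 + h l ^ 2) * P ≠ 0 := by positivity
  have hX : MemLp (fun ω => relayInput c h ω i) 2 (law n R) :=
    (memLp_two_iff_integrable_sq (measurable_relayInput c h i).aestronglyMeasurable).2 hx
  have hJ := memLp_userNoise (n := n) (R := R) j i
  have hL := memLp_userNoise (n := n) (R := R) l i
  have hXJ := hX.integrable_mul hJ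
  have hXL := hX.integrable_mul hL
  have hJL := hJ.integrable_mul hL
  have hJJ := hJ.integrable_sq
  have hLL := hL.integrable_sq
  simp only [Pi.mul_def] at hXJ hXL hJL
  set S := h j ^ 2 + h l ^ 2 with hS
  set K := 1 + S * P with hK
  have hexp : ∀ ω : Messages n R × Noise n,
      infoDensity P (h j) (h l) (relayInput c h ω i) (ω.2.1 j i) (ω.2.1 l i) =
      Real.log K / 2 + h j / K * (relayInput c h ω i * ω.2.1 j i) +
      h l / K * (relayInput c h ω i * ω.2.1 l i) + S / (2 * K) * relayInput c h ω i ^ 2 -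
      P / (2 * K) * h j ^ 2 * ω.2.1 j i ^ 2 - P / (2 * K) * h l ^ 2 * ω.2.1 l i ^ 2 -
      P / K * h j * h l * (ω.2.1 j i * ω.2.1 l i) := by
    intro ω
    simp only [infoDensity, ← hS, ← hK]
    field_simp
    rw [hK, hS]
    ring
  simp_rw [hexp]
  refine ⟨by fun_prop, ?_⟩
  rw [integral_sub (by fun_prop) (by fun_prop), integral_sub (by fun_prop) (by fun_prop),
    integral_sub (by fun_prop) (by fun_prop), integral_add (by fun_prop) (by fun_prop),
    integral_add (by fun_prop) (by fun_prop), integral_add (by fun_prop) (by fun_prop)]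
  simp only [integral_const_mul, integral_relayInput_mul_userNoise, integral_userNoise_sq,
    integral_userNoise_mul_userNoise hjl, integral_const, probReal_univ, one_smul]
  rw [hS]
  ring

theorem integral_sum_infoDensity_le [Nonempty (Messages n R)] (c : Code n R) (h : Fin 3 → ℝ)
    {P : ℝ} (hP : 0 ≤ P) {j l : Fin 3} (hjl : j ≠ l) (hx : PowerConstraint P (relayInput c h)) :
    ∫ ω, ∑ i, infoDensity P (h j) (h l) (relayInput c h ω i) (ω.2.1 j i) (ω.2.1 l i) ∂(law n R) ≤
      n * (Real.log (1 + (h j ^ 2 + h l ^ 2) * P) / 2) := by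
  have hi := fun i => integral_infoDensity c h hP hjl i (hx.1 i)
  have hsum : ∑ i, (∫ ω, relayInput c h ω i ^ 2 ∂(law n R) - P) ≤ 0 := by
    have h1 := hx.2
    -- For `n = 0` the power constraint carries no information because `1 / 0 = 0`, but the sum is
    -- empty.
    rcases Nat.eq_zero_or_pos n with rfl | hn
    · simp
    · have hn' : (0 : ℝ) < n := Nat.cast_pos.2 hn
      rw [one_div, inv_mul_le_iff₀ hn'] at h1
      simpa using h1
  rw [integral_finsetSum _ fun i _ => (hi i).1]
  simp_rw [(hi _).2]
  rw [Finset.sum_add_distrib, ← Finset.mul_sum, Finset.sum_const, Finset.card_univ,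
    Fintype.card_fin, nsmul_eq_mul]
  have h2 : 0 ≤ (h j ^ 2 + h l ^ 2) / (2 * (1 + (h j ^ 2 + h l ^ 2) * P)) := by positivity
  linarith [mul_nonpos_of_nonneg_of_nonpos h2 hsum]

end Expectation

/-! ### Counting messages and the Fano-type bound -/

section Converse

theorem lintegral_messages (f : Messages n R → ENNReal) :
    ∫⁻ m, f m ∂(uniformOn (Set.univ : Set (Messages n R))) =
      (∑ m, f m) / Fintype.card (Messages n R) := by
  rw [uniformOn, ProbabilityTheory.cond, Measure.restrict_univ, lintegral_smul_measure, lintegral_count,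
    tsum_fintype, smul_eq_mul, Measure.count_apply_finite _ Set.finite_univ]
  simp [mul_comm, div_eq_mul_inv]

/-- Change of measure to the Gaussian output law, under which the outputs of users `j` and `l` are
independent of the messages. -/
theorem lintegral_law_mul_exp_neg_infoDensity_le (c : Code n R) (h : Fin 3 → ℝ) {P : ℝ}
    (hP : 0 ≤ P) {j k l : Fin 3} (hjk : j ≠ k) (hjl : j ≠ l) (hkl : k ≠ l)
    (f : Messages n R → (Fin n → ℝ) × (Fin n → ℝ) → ENNReal) (hf : ∀ m, Measurable (f m))
    (K : ENNReal) (hK : ∀ y, ∑ m, f m y ≤ K) :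
    ∫⁻ ω, f ω.1 (userOutput c h ω j, userOutput c h ω l) *
        ENNReal.ofReal (Real.exp (-∑ i, infoDensity P (h j) (h l) (relayInput c h ω i)
          (ω.2.1 j i) (ω.2.1 l i))) ∂(law n R) ≤ K / Fintype.card (Messages n R) := by
  have := isProbabilityMeasure_noiseMeasure n
  have hfm : Measurable fun ω : Messages n R × Noise n =>
      f ω.1 (userOutput c h ω j, userOutput c h ω l) := by
    refine measurable_from_prod_countable_right fun m => (hf m).comp (Measurable.prodMk ?_ ?_)
    · exact (measurable_userOutput c h j).comp measurable_prodMk_left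
    · exact (measurable_userOutput c h l).comp measurable_prodMk_left
  have hem : Measurable fun ω : Messages n R × Noise n =>
      ENNReal.ofReal (Real.exp (-∑ i, infoDensity P (h j) (h l) (relayInput c h ω i)
          (ω.2.1 j i) (ω.2.1 l i))) := by
    have := fun i => measurable_relayInput c h i
    unfold infoDensity
    fun_prop
  let g : Messages n R × Noise n → ENNReal := fun ω =>
    f ω.1 (userOutput c h ω j, userOutput c h ω l) *
      ENNReal.ofReal (Real.exp (-∑ i, infoDensity P (h j) (h l) (relayInput c h ω i)
        (ω.2.1 j i) (ω.2.1 l i)))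
  have hg : Measurable g := hfm.mul hem
  have hin : ∀ m : Messages n R, ∫⁻ ν, g (m, ν) ∂(noiseMeasure n) =
      ∫⁻ y, f m (y j, y l) * outputDensity h P j k l y := by
    intro m
    rw [noiseMeasure, lintegral_prod_symm' (fun ν => g (m, ν)) (hg.comp measurable_prodMk_left)]
    simp only [g]
    simp_rw [lintegral_userOutput_mul_exp_neg_infoDensity c h hP hjk hjl hkl m _ (f m) (hf m)]
    simp
  change ∫⁻ ω, g ω ∂(law n R) ≤ _
  rw [law, lintegral_prod _ hg.aemeasurable]
  simp_rw [hin]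
  rw [lintegral_messages]
  gcongr
  have hfo : ∀ m ∈ (Finset.univ : Finset (Messages n R)), Measurable fun y : Fin 3 → Fin n → ℝ =>
      f m (y j, y l) * outputDensity h P j k l y := fun m _ =>
    ((hf m).comp (by fun_prop)).mul (measurable_outputDensity ..)
  -- The output law is the same for every `m`, so the sum over messages moves inside the integral,
  -- where `hK` applies pointwise.
  rw [← lintegral_finsetSum _ hfo]
  calc ∫⁻ y, ∑ m, f m (y j, y l) * outputDensity h P j k l y
      ≤ ∫⁻ y, K * outputDensity h P j k l y := by
        refine lintegral_mono fun y => ?_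
        rw [← Finset.sum_mul]
        gcongr
        exact hK _
    _ = K := by
        rw [lintegral_const_mul _ (measurable_outputDensity ..),
          lintegral_outputDensity h hP hjk hjl hkl, mul_one]

theorem univ_userPair {j k l : Fin 3} (hjk : j ≠ k) (hjl : j ≠ l) (hkl : k ≠ l) :
    (Finset.univ : Finset UserPair) = {⟨(k, j), hjk.symm⟩, ⟨(l, j), hjl.symm⟩, ⟨(k, l), hkl⟩,
      ⟨(j, k), hjk⟩, ⟨(j, l), hjl⟩, ⟨(l, k), hkl.symm⟩} := by
  decide +revert

theorem eq_or_eq_or_eq {j k l : Fin 3} (hjk : j ≠ k) (hjl : j ≠ l) (hkl : k ≠ l) (a : Fin 3) :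
    a = j ∨ a = k ∨ a = l := by
  decide +revert

theorem card_messages {j k l : Fin 3} (hjk : j ≠ k) (hjl : j ≠ l) (hkl : k ≠ l) :
    Fintype.card (Messages n R) =
      (numMessages n R ⟨(k, j), hjk.symm⟩ * numMessages n R ⟨(l, j), hjl.symm⟩ *
        numMessages n R ⟨(k, l), hkl⟩) *
      (numMessages n R ⟨(j, k), hjk⟩ * numMessages n R ⟨(j, l), hjl⟩ *
        numMessages n R ⟨(l, k), hkl.symm⟩) := by
  have hjk' := hjk.symm
  have hjl' := hjl.symm
  have hkl' := hkl.symm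
  rw [Fintype.card_pi, univ_userPair hjk hjl hkl]
  simp only [Fintype.card_fin]
  rw [Finset.prod_insert (by simp [*]), Finset.prod_insert (by simp [*]),
    Finset.prod_insert (by simp [*]), Finset.prod_insert (by simp [*]),
    Finset.prod_insert (by simp [*]), Finset.prod_singleton]
  ring

/-- Users `j` and `l` decode correctly if they receive `y.1` and `y.2`. -/
def DecodesAt (c : Code n R) (j l : Fin 3) (m : Messages n R)
    (y : (Fin n → ℝ) × (Fin n → ℝ)) : Prop :=
  c.dec j y.1 (outgoing m j) = incoming m j ∧ c.dec l y.2 (outgoing m l) = incoming m l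

open Classical in
/-- Given the outputs of users `j` and `l`, the three messages `m_jk`, `m_jl`, `m_lk` determine
the others when the decoders of users `j` and `l` are correct. -/
theorem card_decodesAt_le (c : Code n R) {j k l : Fin 3} (hjk : j ≠ k) (hjl : j ≠ l) (hkl : k ≠ l)
    (y : (Fin n → ℝ) × (Fin n → ℝ)) :
    (Finset.univ.filter fun m => DecodesAt c j l m y).card ≤
      numMessages n R ⟨(j, k), hjk⟩ * numMessages n R ⟨(j, l), hjl⟩ *
        numMessages n R ⟨(l, k), hkl.symm⟩ := by
  have hcard : (Finset.univ : Finset ((Fin (numMessages n R ⟨(j, k), hjk⟩) ×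
      Fin (numMessages n R ⟨(j, l), hjl⟩)) × Fin (numMessages n R ⟨(l, k), hkl.symm⟩))).card =
      numMessages n R ⟨(j, k), hjk⟩ * numMessages n R ⟨(j, l), hjl⟩ *
        numMessages n R ⟨(l, k), hkl.symm⟩ := by
    simp
  rw [← hcard]
  refine Finset.card_le_card_of_injOn
    (fun m => ((m ⟨(j, k), hjk⟩, m ⟨(j, l), hjl⟩), m ⟨(l, k), hkl.symm⟩))
    (fun _ _ => by simp) ?_
  intro m hm m' hm' heq
  replace hm := (Finset.mem_filter.1 (Finset.mem_coe.1 hm)).2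
  replace hm' := (Finset.mem_filter.1 (Finset.mem_coe.1 hm')).2
  simp only [Prod.mk.injEq] at heq
  obtain ⟨⟨e1, e2⟩, e3⟩ := heq
  have hout : outgoing m j = outgoing m' j := by
    funext ⟨a, ha⟩
    rcases eq_or_eq_or_eq hjk hjl hkl a with rfl | rfl | rfl
    · exact absurd rfl ha
    · exact e1
    · exact e2
  have hinj : incoming m j = incoming m' j := by rw [← hm.1, ← hm'.1, hout]
  have e4 : m ⟨(k, j), hjk.symm⟩ = m' ⟨(k, j), hjk.symm⟩ := congrFun hinj ⟨k, hjk.symm⟩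
  have e5 : m ⟨(l, j), hjl.symm⟩ = m' ⟨(l, j), hjl.symm⟩ := congrFun hinj ⟨l, hjl.symm⟩
  -- The message `m_lj` just decoded by user `j`, together with the given `m_lk`, is everything that
  -- user `l` sends.
  have hout' : outgoing m l = outgoing m' l := by
    funext ⟨a, ha⟩
    rcases eq_or_eq_or_eq hjk hjl hkl a with rfl | rfl | rfl
    · exact e5
    · exact e3
    · exact absurd rfl ha
  have hinl : incoming m l = incoming m' l := by rw [← hm.2, ← hm'.2, hout']
  have e6 : m ⟨(k, l), hkl⟩ = m' ⟨(k, l), hkl⟩ := congrFun hinl ⟨k, hkl⟩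
  funext p
  have hp : p ∈ (Finset.univ : Finset UserPair) := Finset.mem_univ p
  rw [univ_userPair hjk hjl hkl] at hp
  simp only [Finset.mem_insert, Finset.mem_singleton] at hp
  rcases hp with rfl | rfl | rfl | rfl | rfl | rfl <;> assumption

/-- A change of measure bound for the success probability: `exp (-L)` is a likelihood ratio with
respect to which the event `A` has probability at most `1 / N`. -/
theorem measureReal_mul_log_le {Ω : Type*} [MeasurableSpace Ω] (μ : Measure Ω)
    [IsProbabilityMeasure μ] (L : Ω → ℝ) (hL : Integrable L μ) (A : Set Ω) (hA : MeasurableSet A)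
    (N : ℝ) (hN : 1 ≤ N) (h1 : ∫⁻ ω, ENNReal.ofReal (Real.exp (-L ω)) ∂μ ≤ 1)
    (h2 : ∫⁻ ω, A.indicator 1 ω * ENNReal.ofReal (Real.exp (-L ω)) ∂μ ≤ (ENNReal.ofReal N)⁻¹) :
    μ.real A * Real.log N ≤ ∫ ω, L ω ∂μ + Real.log 2 := by
  have hN0 : 0 < N := by linarith
  have hLm := hL.aemeasurable
  -- The Donsker–Varadhan test function. The two hypotheses bound the expectation of `exp T` by `(1
  -- + N * N⁻¹) / 2 = 1`, which is why `log 2` is subtracted.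
  set T : Ω → ℝ := fun ω => -L ω + A.indicator (fun _ => Real.log N) ω - Real.log 2 with hT
  have hind : Integrable (A.indicator fun _ => Real.log N) μ :=
    (integrable_const _).indicator hA
  have hneg : Integrable (fun ω => -L ω) μ := hL.neg
  have hadd : Integrable (fun ω => -L ω + A.indicator (fun _ => Real.log N) ω) μ := hneg.add hind
  have hTi : Integrable T μ := hadd.sub (integrable_const _)
  have hle : ∫⁻ ω, ENNReal.ofReal (Real.exp (T ω)) ∂μ ≤ 1 := by
    have hpt : ∀ ω, ENNReal.ofReal (Real.exp (T ω)) ≤ 2⁻¹ * (ENNReal.ofReal (Real.exp (-L ω)) +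
        ENNReal.ofReal N * (A.indicator 1 ω * ENNReal.ofReal (Real.exp (-L ω)))) := by
      intro ω
      have h2' : (2⁻¹ : ENNReal) = ENNReal.ofReal (2⁻¹) := by
        rw [ENNReal.ofReal_inv_of_pos two_pos]; simp
      by_cases hω : ω ∈ A
      · simp only [hT, Set.indicator_of_mem hω, Pi.one_apply, one_mul]
        rw [Real.exp_sub, Real.exp_add, Real.exp_log hN0, Real.exp_log two_pos, div_eq_inv_mul,
          ENNReal.ofReal_mul (by norm_num), h2', mul_comm (Real.exp _) N,
          ENNReal.ofReal_mul hN0.le]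
        gcongr
        exact le_add_self
      · simp only [hT, Set.indicator_of_notMem hω, zero_mul, mul_zero, add_zero]
        rw [Real.exp_sub, Real.exp_log two_pos, div_eq_inv_mul,
          ENNReal.ofReal_mul (by norm_num), h2']
    calc ∫⁻ ω, ENNReal.ofReal (Real.exp (T ω)) ∂μ
        ≤ ∫⁻ ω, 2⁻¹ * (ENNReal.ofReal (Real.exp (-L ω)) +
          ENNReal.ofReal N * (A.indicator 1 ω * ENNReal.ofReal (Real.exp (-L ω)))) ∂μ :=
          lintegral_mono hpt
      _ = 2⁻¹ * (∫⁻ ω, ENNReal.ofReal (Real.exp (-L ω)) ∂μ +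
          ENNReal.ofReal N * ∫⁻ ω, A.indicator 1 ω * ENNReal.ofReal (Real.exp (-L ω)) ∂μ) := by
          rw [lintegral_const_mul' _ _ (by simp), lintegral_add_left' (by fun_prop),
            lintegral_const_mul' _ _ ENNReal.ofReal_ne_top]
      _ ≤ 2⁻¹ * (1 + ENNReal.ofReal N * (ENNReal.ofReal N)⁻¹) := by gcongr
      _ = 1 := by
          rw [ENNReal.mul_inv_cancel (by simpa using hN0) ENNReal.ofReal_ne_top, one_add_one_eq_two,
            ENNReal.inv_mul_cancel (by simp) (by simp)]
  have hTm : AEMeasurable T μ := hTi.aemeasurable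
  have hei : Integrable (fun ω => Real.exp (T ω)) μ := by
    refine ⟨(Real.measurable_exp.comp_aemeasurable hTm).aestronglyMeasurable, ?_⟩
    rw [hasFiniteIntegral_iff_ofReal (Eventually.of_forall fun _ => (Real.exp_pos _).le)]
    exact lt_of_le_of_lt hle ENNReal.one_lt_top
  have he : ∫ ω, Real.exp (T ω) ∂μ ≤ 1 := by
    rw [integral_eq_lintegral_of_nonneg_ae (Eventually.of_forall fun _ => (Real.exp_pos _).le)
      hei.aestronglyMeasurable]
    exact ENNReal.toReal_le_of_le_ofReal zero_le_one (by simpa using hle)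
  -- The bound `T + 1 ≤ exp T` replaces Jensen's inequality and gives `E T ≤ 0`.
  have hmono : ∫ ω, (T ω + 1) ∂μ ≤ ∫ ω, Real.exp (T ω) ∂μ :=
    integral_mono (hTi.add (integrable_const _)) hei fun ω => Real.add_one_le_exp _
  have hTint : ∫ ω, T ω ∂μ = -∫ ω, L ω ∂μ + μ.real A * Real.log N - Real.log 2 := by
    simp only [hT]
    rw [integral_sub hadd (integrable_const _), integral_add hneg hind,
      integral_neg, integral_indicator_const _ hA]
    simp
  rw [integral_add hTi (integrable_const _), hTint] at hmono
  simp only [integral_const, probReal_univ, one_smul] at hmono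
  linarith

theorem one_sub_errorProb_mul_log_le (c : Code n R) (hR : ∀ p, 0 ≤ R p) (h : Fin 3 → ℝ) {P : ℝ}
    (hP : 0 ≤ P) (hc : c.IsPowerLimited h P) {j k l : Fin 3} (hjk : j ≠ k) (hjl : j ≠ l)
    (hkl : k ≠ l) :
    (1 - c.errorProb h) * Real.log ((numMessages n R ⟨(k, j), hjk.symm⟩ *
        numMessages n R ⟨(l, j), hjl.symm⟩ * numMessages n R ⟨(k, l), hkl⟩ : ℕ) : ℝ) ≤
      n * (Real.log (1 + (h j ^ 2 + h l ^ 2) * P) / 2) + Real.log 2 := by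
  have := nonempty_messages n hR
  have := isProbabilityMeasure_law (n := n) (R := R)
  have hcard := card_messages (n := n) (R := R) hjk hjl hkl
  set N := numMessages n R ⟨(k, j), hjk.symm⟩ * numMessages n R ⟨(l, j), hjl.symm⟩ *
    numMessages n R ⟨(k, l), hkl⟩
  set S := numMessages n R ⟨(j, k), hjk⟩ * numMessages n R ⟨(j, l), hjl⟩ *
    numMessages n R ⟨(l, k), hkl.symm⟩
  have hcpos : 0 < N * S := hcard ▸ Fintype.card_pos
  have hN : 0 < N := Nat.pos_of_mul_pos_right hcpos
  have hS : 0 < S := Nat.pos_of_mul_pos_left hcpos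
  have hdec : ∀ a, MeasurableSet {ω : Messages n R × Noise n |
      c.dec a (userOutput c h ω a) (outgoing ω.1 a) = incoming ω.1 a} := by
    intro a
    refine (measurable_from_prod_countable_right fun m => ?_ : Measurable fun ω =>
      c.dec a (userOutput c h ω a) (outgoing ω.1 a) = incoming ω.1 a).setOf
    refine Measurable.eq ?_ (measurable_const (a := incoming m a))
    exact (c.measurable_dec a (outgoing m a)).comp
      ((measurable_userOutput c h a).comp measurable_prodMk_left)
  set A := {ω : Messages n R × Noise n |
    ∀ a, c.dec a (userOutput c h ω a) (outgoing ω.1 a) = incoming ω.1 a} with hA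
  have hAm : MeasurableSet A := by
    rw [hA, Set.ofPred_forall]
    exact MeasurableSet.iInter hdec
  have herr : (law n R).real A = 1 - c.errorProb h := by
    have : {ω | ∃ a, c.dec a (userOutput c h ω a) (outgoing ω.1 a) ≠ incoming ω.1 a} = Aᶜ := by
      ext ω
      simp [hA]
    rw [Code.errorProb, this, probReal_compl_eq_one_sub hAm]
    ring
  let L : Messages n R × Noise n → ℝ := fun ω =>
    ∑ i, infoDensity P (h j) (h l) (relayInput c h ω i) (ω.2.1 j i) (ω.2.1 l i)
  have hL : Integrable L (law n R) :=
    integrable_finsetSum _ fun i _ => (integral_infoDensity c h hP hjl i (hc.2.1 i)).1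
  have h1 : ∫⁻ ω, ENNReal.ofReal (Real.exp (-L ω)) ∂(law n R) ≤ 1 := by
    have := lintegral_law_mul_exp_neg_infoDensity_le c h hP hjk hjl hkl (fun _ _ => 1)
      (fun _ => measurable_const) (Fintype.card (Messages n R)) (fun y => by simp)
    simp only [one_mul] at this
    exact this.trans ENNReal.div_self_le_one
  have h2 : ∫⁻ ω, A.indicator 1 ω * ENNReal.ofReal (Real.exp (-L ω)) ∂(law n R) ≤
      (ENNReal.ofReal (N : ℝ))⁻¹ := by
    classical
    have hB : ∀ m : Messages n R, MeasurableSet {y | DecodesAt c j l m y} := fun m =>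
      (measurableSet_eq_fun ((c.measurable_dec j _).comp measurable_fst) measurable_const).inter
        (measurableSet_eq_fun ((c.measurable_dec l _).comp measurable_snd) measurable_const)
    have := lintegral_law_mul_exp_neg_infoDensity_le c h hP hjk hjl hkl
      (fun m => {y | DecodesAt c j l m y}.indicator 1)
      (fun m => measurable_one.indicator (hB m)) S (fun y => by
        have := card_decodesAt_le (R := R) c hjk hjl hkl y
        simp only [Set.indicator_apply, Set.mem_ofPred_eq, Pi.one_apply, Finset.sum_boole]
        exact_mod_cast this)
    -- `A` asks all three users to decode correctly; only users `j` and `l` are kept. Of the `N * S`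
    -- message vectors at most `S` fit a given pair of outputs, hence the bound `1 / N`.
    refine le_trans (lintegral_mono fun ω => ?_) (this.trans ?_)
    · gcongr
      by_cases hω : ω ∈ A
      · have : (userOutput c h ω j, userOutput c h ω l) ∈ {y | DecodesAt c j l ω.1 y} :=
          ⟨hω j, hω l⟩
        rw [Set.indicator_of_mem hω, Set.indicator_of_mem this]
        rfl
      · rw [Set.indicator_of_notMem hω]
        exact zero_le
    · have hS' : (S : ENNReal) ≠ 0 := by exact_mod_cast hS.ne'
      rw [hcard, ENNReal.ofReal_natCast, Nat.cast_mul N S, ← one_div]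
      have hdiv := ENNReal.mul_div_mul_right 1 (N : ENNReal) hS' (ENNReal.natCast_ne_top S)
      rw [one_mul] at hdiv
      exact hdiv.le
  have key := measureReal_mul_log_le (law n R) L hL A hAm N (by exact_mod_cast hN) h1 h2
  rw [herr] at key
  have := integral_sum_infoDensity_le c h hP hjl hc.2
  linarith

/-- For `x ≥ 1` the floor of `x` is at least `x / 2`, so rounding costs at most one bit. -/
theorem log_numMessages_ge (n : ℕ) (p : UserPair) (hR : 0 ≤ R p) :
    n * R p * Real.log 2 - Real.log 2 ≤ Real.log (numMessages n R p) := by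
  have h1 : (1 : ℝ) ≤ 2 ^ ((n : ℝ) * R p) := Real.one_le_rpow one_le_two (by positivity)
  have h2 : (2 : ℝ) ^ ((n : ℝ) * R p) / 2 ≤ numMessages n R p := by
    have h3 := Nat.lt_floor_add_one ((2 : ℝ) ^ ((n : ℝ) * R p))
    have h4 : (1 : ℝ) ≤ numMessages n R p := by exact_mod_cast Nat.floor_pos.2 h1
    unfold numMessages at h4 ⊢
    linarith
  have h5 := Real.log_le_log (by positivity) h2
  rwa [Real.log_div (by positivity) two_ne_zero, Real.log_rpow two_pos] at h5

end Converse

end YChannel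

/-! ### The limit of large block length -/

theorem mainTheorem4 (h : Fin 3 → ℝ) (P : ℝ) (hP : 0 ≤ P) (R : YChannel.UserPair → ℝ)
    (hR : YChannel.Achievable h P R) (j k l : Fin 3) (hjk : j ≠ k) (hjl : j ≠ l) (hkl : k ≠ l) :
    R ⟨(k, j), hjk.symm⟩ + R ⟨(l, j), hjl.symm⟩ + R ⟨(k, l), hkl⟩ ≤
      YChannel.C ((h j ^ 2 + h l ^ 2) * P) := by
  obtain ⟨hR0, c, hc, hlim⟩ := hR
  set ρ := R ⟨(k, j), hjk.symm⟩ + R ⟨(l, j), hjl.symm⟩ + R ⟨(k, l), hkl⟩ with hρ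
  set Λ := Real.log (1 + (h j ^ 2 + h l ^ 2) * P) / 2 with hΛ
  have hlog2 : 0 < Real.log 2 := Real.log_pos one_lt_two
  -- The term `3 * log 2 / n` is the rounding loss of three message sets. The bound `errorProb ≤ 1`
  -- keeps the left factor nonnegative; it is obtained below, eventually, from the limit.
  have hn : ∀ n : ℕ, 0 < n → (c n).errorProb h ≤ 1 →
      (1 - (c n).errorProb h) * (ρ * Real.log 2 - 3 * Real.log 2 / n) ≤
        Λ + Real.log 2 / n := by
    intro n hn0 he
    have hn' : (0 : ℝ) < n := Nat.cast_pos.2 hn0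
    have key := YChannel.one_sub_errorProb_mul_log_le (c n) hR0 h hP (hc n) hjk hjl hkl
    have hpos : ∀ p, (YChannel.numMessages n R p : ℝ) ≠ 0 := fun p =>
      Nat.cast_ne_zero.2 (Nat.floor_pos.2 (Real.one_le_rpow one_le_two (by
        have := hR0 p
        positivity))).ne'
    rw [Nat.cast_mul, Nat.cast_mul, Real.log_mul (mul_ne_zero (hpos _) (hpos _)) (hpos _),
      Real.log_mul (hpos _) (hpos _)] at key
    have hlow : n * (ρ * Real.log 2 - 3 * Real.log 2 / n) ≤
        Real.log (YChannel.numMessages n R ⟨(k, j), hjk.symm⟩) +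
        Real.log (YChannel.numMessages n R ⟨(l, j), hjl.symm⟩) +
        Real.log (YChannel.numMessages n R ⟨(k, l), hkl⟩) := by
      have h1 := YChannel.log_numMessages_ge n _ (hR0 ⟨(k, j), hjk.symm⟩)
      have h2 := YChannel.log_numMessages_ge n _ (hR0 ⟨(l, j), hjl.symm⟩)
      have h3 := YChannel.log_numMessages_ge n _ (hR0 ⟨(k, l), hkl⟩)
      have h4 : n * (ρ * Real.log 2 - 3 * Real.log 2 / n) =
          n * ρ * Real.log 2 - 3 * Real.log 2 := by
        field_simp
      rw [h4, hρ]
      linarith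
    have h5 := (mul_le_mul_of_nonneg_left hlow (sub_nonneg.2 he)).trans key
    have h6 : n * (Λ + Real.log 2 / n) = n * Λ + Real.log 2 := by field_simp
    refine le_of_mul_le_mul_left ?_ hn'
    rw [h6, mul_left_comm]
    exact h5
  have ht : Tendsto (fun n : ℕ => (1 - (c n).errorProb h) *
      (ρ * Real.log 2 - 3 * Real.log 2 / n)) atTop (𝓝 ((1 - 0) * (ρ * Real.log 2 - 0))) :=
    (tendsto_const_nhds.sub hlim).mul
      (tendsto_const_nhds.sub (tendsto_const_div_atTop_nhds_zero_nat _))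
  have ht' : Tendsto (fun n : ℕ => Λ + Real.log 2 / n) atTop (𝓝 (Λ + 0)) :=
    tendsto_const_nhds.add (tendsto_const_div_atTop_nhds_zero_nat _)
  have hfin := le_of_tendsto_of_tendsto ht ht' (by
    filter_upwards [eventually_gt_atTop 0, hlim.eventually_le_const zero_lt_one] with n h0 h1
    exact hn n h0 h1)
  rw [YChannel.C, Real.logb, ← mul_div_assoc, le_div_iff₀ hlog2]
  simp only [sub_zero, one_mul, add_zero] at hfin
  linarith
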